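/- Let $\Sigma$ be a finite alphabet with at least two symbols. For a finite string $u\in\Sigma^*$ let $\Gamma_u\subseteq\Sigma^\omega$ be the set of infinite strings that have $u$ as a prefix; for $t\in\mathbb N=\{0,1,2,\dots\}$ let $\mathcal F_t:=\sigma(\{\Gamma_u : u\in\Sigma^t\})$, and let $\mathcal F_\omega:=\sigma(\bigcup_t\mathcal F_t)$. For $v\in\Sigma^\omega$ write $v_{1:t}$ for its prefix of length $t$. A probability measure $P$ on $(\Sigma^\omega,\mathcal F_\omega)$ has *perpetual entropy* if there is an $\varepsilon>0$ such that for every $u\in\Sigma^*$ with $P(\Gamma_u)>0$ and every $v\in\Sigma^\omega$ there are $s\in\Sigma$ and $t\in\mathbb N$ for which the conditional probability $P(\Gamma_{uv_{1:t}s}\mid\Gamma_{uv_{1:t}})$ is defined and $1-\varepsilon>P(\Gamma_{uv_{1:t}s}\mid\Gamma_{uv_{1:t}})>\varepsilon$. For a real-valued process $X=(X_t)_{t\in\mathbb N}$ and reals $a<b$ put $T_0:=0$, $T_{2k+1}:=\inf\{t>T_{2k} : X_t\le a\}$, $T_{2k+2}:=\inf\{t>T_{2k+1} : X_t\ge b\}$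 (with $\inf\emptyset=\infty$), $U^X_t(a,b):=\sup\{k\ge0 : T_{2k}\le t\}$, and let $U^X(a,b):=\sup_{t\in\mathbb N}U^X_t(a,b)\in\mathbb N\cup\{\infty\}$ be the total number of upcrossings. Dubins' inequality states that every nonnegative $P$-martingale $X$ satisfies, for all $b>a>0$ and $k\in\mathbb N$, $$P[U^X(a,b)\ge k]\le\left(\tfrac ab\right)^k\,\mathbb E\left[\min\left\{\tfrac{X_0}{a},1\right\}\right].$$ **Corollary (Tightness of Dubins' inequality).** Let $P$ be a probability measure on $(\Sigma^\omega,\mathcal F_\omega)$ with perpetual entropy. For all reals $b>a>0$ there is a nonnegative $P$-martingale $X=(X_t)_{t\in\mathbb N}$ with respect to $(\mathcal F_t)_{t\in\mathbb N}$, with $X_0=a$, that makes Dubins' inequality tight: for every $k\in\mathbb N$, $$P[U^X(a,b)\ge k]=\frac{a^k}{b^k}=\left(\tfrac ab\right)^k\,\mathbb E\left[\min\left\{\tfrac{X_0}{a},1\right\}\right].$$ -/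

import Mathlib

open MeasureTheory ProbabilityTheory

/-- Infinite strings over the alphabet `S`; the symbol `v_{i+1}` of `v` is `v i`. -/
def InfString (S : Type*) : Type _ := ℕ → S

namespace InfString

/-- The prefix `v_{1:t}` of length `t`. -/
def take {S : Type*} (v : InfString S) (t : ℕ) : List S := List.ofFn fun i : Fin t => v i

/-- The cylinder set `Γ_u` of all infinite strings that have the finite string `u` as a prefix. -/
def cylinder {S : Type*} (u : List S) : Set (InfString S) := {v | v.take u.length = u}

/-- The σ-algebra `F_t` generated by the cylinder sets of the strings of length `t`. -/
@[reducible] def sigmaAlg (S : Type*) (t : ℕ) : MeasurableSpace (InfString S) :=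
  MeasurableSpace.generateFrom {A | ∃ u : List S, u.length = t ∧ A = cylinder u}

/-- The σ-algebra `F_ω` generated by all the `F_t`. -/
instance instMeasurableSpace (S : Type*) : MeasurableSpace (InfString S) := ⨆ t, sigmaAlg S t

theorem take_succ {S : Type*} (v : InfString S) (t : ℕ) : v.take (t + 1) = v.take t ++ [v t] := by
  rw [take, take, List.ofFn_succ_last]
  simp

theorem cylinder_eq_iUnion {S : Type*} (u : List S) :
    cylinder u = ⋃ a : S, cylinder (u ++ [a]) := by
  ext v
  simp [cylinder, take_succ]

theorem sigmaAlg_le_succ (S : Type*) [Finite S] (t : ℕ) : sigmaAlg S t ≤ sigmaAlg S (t + 1) := by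
  refine MeasurableSpace.generateFrom_le ?_
  rintro _ ⟨u, rfl, rfl⟩
  rw [cylinder_eq_iUnion]
  exact MeasurableSet.iUnion fun a =>
    MeasurableSpace.measurableSet_generateFrom ⟨u ++ [a], by simp, rfl⟩

/-- The filtration `(F_t)`. -/
def filtration (S : Type*) [Finite S] : Filtration ℕ (instMeasurableSpace S) where
  seq := sigmaAlg S
  mono' := monotone_nat_of_le_succ (sigmaAlg_le_succ S)
  le' := le_iSup (sigmaAlg S)

/-- Perpetual entropy: there is `ε > 0` such that for all `u`, `v` with `P(Γ_u) > 0` there are a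
symbol `a` and a time `t` with `1 - ε > P(Γ_{u v_{1:t} a} | Γ_{u v_{1:t}}) > ε`.
(`ProbabilityTheory.cond` is zero if the condition has probability zero, so that the
inequality `> ε` fails when the conditional probability is undefined.) -/
def PerpetualEntropy {S : Type*} (P : Measure (InfString S)) : Prop :=
  ∃ ε : ℝ, 0 < ε ∧ ∀ (u : List S) (v : InfString S), 0 < P (cylinder u) →
    ∃ (a : S) (t : ℕ),
      ε < (cond P (cylinder (u ++ v.take t))).real (cylinder (u ++ v.take t ++ [a])) ∧
      (cond P (cylinder (u ++ v.take t))).real (cylinder (u ++ v.take t ++ [a])) < 1 - ε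

end InfString

/-- The first time `s > t` at which the path `x` lies in `A`; it is `∞` if there is none. -/
noncomputable def hitAfter (x : ℕ → ℝ) (A : Set ℝ) (t : ℕ∞) : ℕ∞ :=
  sInf {s : ℕ∞ | ∃ n : ℕ, s = n ∧ t < n ∧ x n ∈ A}

/-- The times `T_0 = 0`, `T_{2k+1} = inf {t > T_{2k} | x_t ≤ a}` and
`T_{2k+2} = inf {t > T_{2k+1} | x_t ≥ b}` of the path `x`. -/
noncomputable def crossingTime (a b : ℝ) (x : ℕ → ℝ) : ℕ → ℕ∞
  | 0 => 0
  | n + 1 => hitAfter x (if Even n then Set.Iic a else Set.Ici b) (crossingTime a b x n)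

/-- `U_t(a, b) = sup {k | T_{2k} ≤ t}`, the number of upcrossings up to time `t`. -/
noncomputable def upcrossingCountUpTo (a b : ℝ) (x : ℕ → ℝ) (t : ℕ) : ℕ∞ :=
  sSup {m : ℕ∞ | ∃ k : ℕ, m = k ∧ crossingTime a b x (2 * k) ≤ t}

/-- `U(a, b) = sup_t U_t(a, b)`, the total number of upcrossings of the path `x`. -/
noncomputable def upcrossingCount (a b : ℝ) (x : ℕ → ℝ) : ℕ∞ :=
  ⨆ t : ℕ, upcrossingCountUpTo a b x t

/-! Dubins' inequality is lost only through overshoot at the levels, or through probability that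
never settles; a strategy of fair bets can avoid both. While waiting for a value `≤ a`, the capital
stays `≥ a` and each bet has `a` as one of its outcomes; while waiting for a value `≥ b`, the
capital stays in `[0, b]` and each bet has `b` or `0` as one of its outcomes. Hence phases switch
exactly at `a` and `b`, and `0` is absorbing.

The candidate `reachProb` for the probability of completing `k` upcrossings is affine in the capital
within a phase and continuous across switches, precisely because there is no overshoot. It is
therefore a bounded martingale along the play (`reachProb_fair`, `martingale_comp_state`) with
initial value `(a / b) ^ k`.

Perpetual entropy supplies infinitely many bets whose two outcomes both have conditional probability
above `ε`, so by the conditional Borel–Cantelli lemma almost surely infinitely many bets reach their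
aim (`ae_frequently_winsAt`). Each of these advances the phase or ruins the player, so `reachProb`
converges to the indicator of at least `k` upcrossings, and dominated convergence identifies the
probability. -/

/-! ### Crossing times as a recursive phase counter -/

/-- The index of the phase after the value `y` has been reached in phase `n`: in an even phase one
waits for a value `≤ a`, in an odd one for a value `≥ b`. -/
noncomputable def nextPhase (a b : ℝ) (n : ℕ) (y : ℝ) : ℕ :=
  open scoped Classical in
  if y ∈ (if Even n then Set.Iic a else Set.Ici b) then n + 1 else n

theorem le_nextPhase (a b : ℝ) (n : ℕ) (y : ℝ) : n ≤ nextPhase a b n y := by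
  unfold nextPhase; split_ifs <;> omega

theorem nextPhase_le (a b : ℝ) (n : ℕ) (y : ℝ) : nextPhase a b n y ≤ n + 1 := by
  unfold nextPhase; split_ifs <;> omega

theorem crossingTime_succ_le_iff (a b : ℝ) (x : ℕ → ℝ) (n t : ℕ) :
    crossingTime a b x (n + 1) ≤ t ↔
      ∃ m : ℕ, m ≤ t ∧ crossingTime a b x n < m ∧
        x m ∈ (if Even n then Set.Iic a else Set.Ici b) := by
  rw [crossingTime, hitAfter]
  constructor
  · intro h
    -- A strict bound on the infimum is needed to extract an element of the set.
    have h1 := lt_of_le_of_lt h (ENat.natCast_lt_succ (n := t))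
    obtain ⟨s, ⟨m, rfl, hm, hx⟩, hs⟩ := sInf_lt_iff.1 h1
    refine ⟨m, ?_, hm, hx⟩
    have : m < t + 1 := by exact_mod_cast hs
    omega
  · rintro ⟨m, hmt, hm, hx⟩
    have hmt' : (m : ℕ∞) ≤ t := by exact_mod_cast hmt
    exact le_trans (sInf_le ⟨m, rfl, hm, hx⟩) hmt'

/-- Finite crossing times increase strictly, so at most one is passed per step and `N` counts them.
The value `x 0` is never read, since the first crossing is sought strictly after time 0. -/
theorem crossingTime_le_iff {a b : ℝ} {x : ℕ → ℝ} {N : ℕ → ℕ} (h0 : N 0 = 0)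
    (hN : ∀ t, N (t + 1) = nextPhase a b (N t) (x (t + 1))) (n t : ℕ) :
    crossingTime a b x n ≤ t ↔ n ≤ N t := by
  have hmono : Monotone N := monotone_nat_of_le_succ fun t => by
    rw [hN]; exact le_nextPhase ..
  induction n generalizing t with
  | zero => simp [crossingTime]
  | succ n ih =>
    rw [crossingTime_succ_le_iff]
    constructor
    · rintro ⟨m, hmt, hm, hx⟩
      obtain _ | m := m
      · simp at hm
      have hnm : n ≤ N m := by
        refine (ih m).1 ?_
        exact ENat.lt_natCast_add_one_iff.1 (by exact_mod_cast hm)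
      refine le_trans ?_ (hmono hmt)
      rcases hnm.eq_or_lt with h | h
      · subst h
        rw [hN, nextPhase, if_pos hx]
      · exact h.trans_le (hmono (Nat.le_succ m))
    · intro h
      induction t with
      | zero => omega
      | succ t iht =>
        by_cases ht : n + 1 ≤ N t
        · obtain ⟨m, hmt, hm⟩ := iht ht
          exact ⟨m, by omega, hm⟩
        · have hle := nextPhase_le a b (N t) (x (t + 1))
          rw [← hN] at hle
          have hn : n = N t := by omega
          refine ⟨t + 1, le_rfl, ?_, ?_⟩
          · refine lt_of_le_of_lt ((ih t).2 hn.le) ?_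
            exact_mod_cast Nat.lt_succ_self t
          · by_contra hx
            have := hN t
            rw [← hn, nextPhase, if_neg hx] at this
            omega

theorem natCast_le_upcrossingCount_iff {a b : ℝ} {x : ℕ → ℝ} {N : ℕ → ℕ} (h0 : N 0 = 0)
    (hN : ∀ t, N (t + 1) = nextPhase a b (N t) (x (t + 1))) (k : ℕ) :
    (k : ℕ∞) ≤ upcrossingCount a b x ↔ ∃ t, 2 * k ≤ N t := by
  constructor
  · intro h
    obtain _ | k := k
    · exact ⟨0, by simp⟩
    have h1 : (k : ℕ∞) < upcrossingCount a b x :=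
      lt_of_lt_of_le (by exact_mod_cast Nat.lt_succ_self k) h
    obtain ⟨t, ht⟩ := lt_iSup_iff.1 h1
    obtain ⟨_, ⟨j, rfl, hj⟩, hkj⟩ := lt_sSup_iff.1 ht
    have hkj' : k < j := by exact_mod_cast hkj
    have := (crossingTime_le_iff h0 hN _ _).1 hj
    exact ⟨t, by omega⟩
  · rintro ⟨t, ht⟩
    refine le_trans ?_ (le_iSup (upcrossingCountUpTo a b x) t)
    exact le_sSup ⟨k, rfl, (crossingTime_le_iff h0 hN _ _).2 ht⟩

/-! ### One step of the betting strategy -/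

/-- A fair bet in phase `n` with capital `x` on an event of probability `q`: in an even phase it
aims at `a`, in an odd one at `0` and `b`. -/
noncomputable def wager (a b q : ℝ) (hit : Prop) (n : ℕ) (x : ℝ) : ℝ :=
  open scoped Classical in
  if Even n then if hit then a else (x - q * a) / (1 - q)
  else if q * b ≤ x then if hit then b else (x - q * b) / (1 - q)
  else if hit then x / q else 0

/-- The outcome of the event that makes the bet `wager` reach its aim. -/
def WagerWins (b q : ℝ) (hit : Prop) (n : ℕ) (x : ℝ) : Prop :=
  if Even n ∨ q * b ≤ x then hit else ¬ hit

/-- One step of the strategy: the bet is placed if `bet` holds. -/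
noncomputable def play (a b : ℝ) (bet : Prop) (q : ℝ) (hit : Prop) (z : ℕ × ℝ) : ℕ × ℝ :=
  open scoped Classical in
  let y := if bet then wager a b q hit z.1 z.2 else z.2
  (nextPhase a b z.1 y, y)

/-- The pairs of a phase and a capital that the strategy can reach. -/
def Admissible (a b : ℝ) (z : ℕ × ℝ) : Prop :=
  0 ≤ z.2 ∧ (Even z.1 → a ≤ z.2) ∧ (¬ Even z.1 → z.2 ≤ b)

section Play

variable {a b q : ℝ} {bet : Prop} {z : ℕ × ℝ}

theorem wager_fair (hq0 : 0 < q) (hq1 : q < 1) (n : ℕ) (x : ℝ) :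
    q * wager a b q True n x + (1 - q) * wager a b q False n x = x := by
  have : 1 - q ≠ 0 := by linarith
  unfold wager
  by_cases hn : Even n
  · simp only [hn, if_true, if_false]
    field_simp
    ring
  · by_cases hx : q * b ≤ x
    · simp only [hn, hx, if_true, if_false]
      field_simp
      ring
    · simp only [hn, hx, if_true, if_false]
      field_simp
      ring

theorem play_of_bet (hb : bet) (hit : Prop) (z : ℕ × ℝ) : play a b bet q hit z =
    (nextPhase a b z.1 (wager a b q hit z.1 z.2), wager a b q hit z.1 z.2) := by
  simp only [play, if_pos hb]

theorem play_of_not_bet (hb : ¬ bet) (hit : Prop) (z : ℕ × ℝ) :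
    play a b bet q hit z = (nextPhase a b z.1 z.2, z.2) := by
  simp only [play, if_neg hb]

theorem play_fair (hq : bet → 0 < q ∧ q < 1) (z : ℕ × ℝ) :
    q * (play a b bet q True z).2 + (1 - q) * (play a b bet q False z).2 = z.2 := by
  by_cases hb : bet
  · rw [play_of_bet hb, play_of_bet hb]
    exact wager_fair (hq hb).1 (hq hb).2 z.1 z.2
  · rw [play_of_not_bet hb, play_of_not_bet hb]
    ring

/-- The bounds refer to the phase before the step. A switch needs the opposite inequality, so it can
only happen at exactly `a` or exactly `b`. -/
theorem play_snd_bounds (ha : 0 < a) (hab : a < b) (hq : bet → 0 < q ∧ q < 1)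
    (hz : Admissible a b z) (hit : Prop) :
    0 ≤ (play a b bet q hit z).2 ∧ (Even z.1 → a ≤ (play a b bet q hit z).2) ∧
      (¬ Even z.1 → (play a b bet q hit z).2 ≤ b) := by
  by_cases hb : bet
  · obtain ⟨hq0, hq1⟩ := hq hb
    have h1 : 0 < 1 - q := by linarith
    obtain ⟨n, x⟩ := z
    obtain ⟨h0, he, ho⟩ := hz
    rw [play_of_bet hb]
    simp only [wager] at h0 he ho ⊢
    by_cases hn : Even n
    · have hx := he hn
      simp only [hn, if_true, not_true, false_imp_iff, and_true, true_imp_iff]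
      split_ifs
      · exact ⟨ha.le, le_rfl⟩
      · have : a ≤ (x - q * a) / (1 - q) := by rw [le_div_iff₀ h1]; linarith
        exact ⟨ha.le.trans this, this⟩
    · have hx := ho hn
      simp only [hn, if_false, not_false_iff, false_imp_iff, true_and, true_imp_iff]
      split_ifs with h2
      · exact ⟨by linarith, le_rfl⟩
      · exact ⟨div_nonneg (by linarith) h1.le, by rw [div_le_iff₀ h1]; linarith⟩
      · exact ⟨by positivity, by rw [div_le_iff₀ hq0]; linarith⟩
      · exact ⟨le_rfl, by linarith⟩
  · rw [play_of_not_bet hb]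
    exact hz

theorem Admissible.play (ha : 0 < a) (hab : a < b) (hq : bet → 0 < q ∧ q < 1)
    (hz : Admissible a b z) (hit : Prop) : Admissible a b (play a b bet q hit z) := by
  obtain ⟨h0, he, ho⟩ := play_snd_bounds ha hab hq hz hit
  have hfst : (_root_.play a b bet q hit z).1 =
    nextPhase a b z.1 (_root_.play a b bet q hit z).2 := rfl
  refine ⟨h0, ?_⟩
  rw [hfst]
  generalize (_root_.play a b bet q hit z).2 = y at *
  unfold nextPhase
  by_cases hn : Even z.1
  · have := he hn
    simp only [hn, if_true, Set.mem_Iic]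
    split_ifs with h
    · simp only [Nat.even_add_one, hn]
      exact ⟨fun h => absurd trivial h, fun _ => by linarith⟩
    · simp only [hn]
      exact ⟨fun _ => this, fun h => absurd trivial h⟩
  · have := ho hn
    simp only [hn, if_false, Set.mem_Ici]
    split_ifs with h
    · simp only [Nat.even_add_one, hn]
      exact ⟨fun _ => by linarith, fun h => absurd not_false h⟩
    · simp only [hn]
      exact ⟨fun h => h.elim, fun _ => this⟩

/-- In an odd phase with `x < q * b`, even staking everything cannot reach `b`; there the aim is
ruin, attained when the event fails. -/
theorem play_of_wins (hit : Prop) (hb : bet) (h : WagerWins b q hit z.1 z.2) :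
    (play a b bet q hit z).1 = z.1 + 1 ∨
      ¬ Even (play a b bet q hit z).1 ∧ (play a b bet q hit z).2 = 0 := by
  obtain ⟨n, x⟩ := z
  rw [play_of_bet hb]
  simp only [WagerWins, wager, nextPhase] at h ⊢
  by_cases hn : Even n
  · have hh : hit := by simpa [hn] using h
    simp [hn, hh]
  · by_cases hx : q * b ≤ x
    · have hh : hit := by simpa [hn, hx] using h
      simp [hn, hh, hx]
    · have hh : ¬ hit := by simpa [hn, hx] using h
      simp only [hn, hh, hx, if_false, and_true]
      split_ifs <;> simp [hn]

/-- With capital 0 the test `q * b ≤ 0` fails, and staking everything returns 0 on either outcome.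
-/
theorem play_of_ruined (hb0 : 0 < b) (hq : bet → 0 < q) (hit : Prop) (hn : ¬ Even z.1)
    (hx : z.2 = 0) : play a b bet q hit z = z := by
  obtain ⟨n, x⟩ := z
  simp only at hn hx
  subst hx
  have h0 : nextPhase a b n 0 = n := by simp [nextPhase, hn, hb0]
  by_cases hb : bet
  · have : ¬ q * b ≤ 0 := by have := mul_pos (hq hb) hb0; linarith
    have hw : wager a b q hit n 0 = 0 := by simp [wager, hn, this]
    rw [play_of_bet hb, hw, h0]
  · rw [play_of_not_bet hb, h0]

/-- The probability, from phase `n` with capital `x`, that the phase `2 * k` will be reached. -/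
noncomputable def reachProb (a b : ℝ) (k : ℕ) (z : ℕ × ℝ) : ℝ :=
  if 2 * k ≤ z.1 then 1 else if Even z.1 then (a / b) ^ (k - z.1 / 2)
    else z.2 / b * (a / b) ^ (k - z.1 / 2 - 1)

theorem reachProb_mem_Icc (ha : 0 < a) (hab : a < b) (k : ℕ) (hz : Admissible a b z) :
    reachProb a b k z ∈ Set.Icc 0 1 := by
  have hb : 0 < b := ha.trans hab
  have h0 : 0 ≤ a / b := by positivity
  have h1 : a / b ≤ 1 := (div_le_one hb).2 hab.le
  unfold reachProb
  split_ifs with h2 h3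
  · simp
  · exact ⟨pow_nonneg h0 _, pow_le_one₀ h0 h1⟩
  · have := div_le_one_of_le₀ (hz.2.2 h3) hb.le
    have h4 : 0 ≤ z.2 / b := div_nonneg hz.1 hb.le
    exact ⟨mul_nonneg h4 (pow_nonneg h0 _), mul_le_one₀ this (pow_nonneg h0 _)
      (pow_le_one₀ h0 h1)⟩

/-- The slope `c` does not depend on the outcome, so fairness of the capital passes to `reachProb`.
This includes steps that switch the phase, because the formulas of adjacent phases agree at `a` and
at `b`. -/
theorem reachProb_play_eq (ha : 0 < a) (hab : a < b) (hq : bet → 0 < q ∧ q < 1) (k : ℕ)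
    (hz : Admissible a b z) :
    ∃ c : ℝ, ∀ hit : Prop, reachProb a b k (play a b bet q hit z) =
      reachProb a b k z + c * ((play a b bet q hit z).2 - z.2) := by
  have hb : b ≠ 0 := (ha.trans hab).ne'
  by_cases hk : 2 * k ≤ z.1
  · refine ⟨0, fun hit => ?_⟩
    have : 2 * k ≤ (play a b bet q hit z).1 := hk.trans (le_nextPhase ..)
    simp [reachProb, hk, this]
  refine ⟨if Even z.1 then 0 else (a / b) ^ (k - z.1 / 2 - 1) / b, fun hit => ?_⟩
  obtain ⟨-, he, ho⟩ := play_snd_bounds ha hab hq hz hit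
  have hfst : (play a b bet q hit z).1 = nextPhase a b z.1 (play a b bet q hit z).2 := rfl
  unfold reachProb
  rw [hfst]
  generalize (play a b bet q hit z).2 = y at *
  obtain ⟨n, x⟩ := z
  simp only at *
  by_cases hn : Even n
  · have := he hn
    obtain ⟨j, rfl⟩ := hn.two_dvd
    by_cases hy : y ≤ a
    · obtain rfl : y = a := le_antisymm hy this
      have h1 : nextPhase y b (2 * j) y = 2 * j + 1 := by simp [nextPhase]
      have h2 : ¬ 2 * k ≤ 2 * j + 1 := by omega
      have h3 : (2 * j + 1) / 2 = j := by omega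
      have h4 : k - j = k - j - 1 + 1 := by omega
      have h5 : 2 * j / 2 = j := by omega
      rw [h1, if_neg h2, if_neg hk, if_pos hn, if_pos hn, if_neg (by simp), h3, h5, h4, pow_succ,
        Nat.add_sub_cancel]
      ring
    · have h1 : nextPhase a b (2 * j) y = 2 * j := by simp [nextPhase, hy]
      rw [h1]
      simp [hn]
  · have := ho hn
    have hodd := hn
    rw [Nat.not_even_iff_odd] at hodd
    obtain ⟨j, rfl⟩ := hodd
    have h3 : (2 * j + 1) / 2 = j := by omega
    rw [if_neg hk, if_neg hn, if_neg hn, h3]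
    by_cases hy : b ≤ y
    · obtain rfl : y = b := le_antisymm this hy
      have h1 : nextPhase a y (2 * j + 1) y = 2 * j + 1 + 1 := by simp [nextPhase]
      rw [h1]
      by_cases h2 : 2 * k ≤ 2 * j + 1 + 1
      · have h4 : k - j - 1 = 0 := by omega
        rw [if_pos h2, h4]
        field_simp
        ring
      · have h4 : k - (2 * j + 1 + 1) / 2 = k - j - 1 := by omega
        rw [if_neg h2, if_pos (by simp [Nat.even_add_one]), h4]
        field_simp
        ring
    · have h1 : nextPhase a b (2 * j + 1) y = 2 * j + 1 := by simp [nextPhase, hy]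
      rw [h1, if_neg hk, if_neg hn, h3]
      field_simp
      ring

theorem reachProb_fair (ha : 0 < a) (hab : a < b) (hq : bet → 0 < q ∧ q < 1) (k : ℕ)
    (hz : Admissible a b z) :
    q * reachProb a b k (play a b bet q True z) +
      (1 - q) * reachProb a b k (play a b bet q False z) = reachProb a b k z := by
  obtain ⟨c, hc⟩ := reachProb_play_eq ha hab hq k hz
  rw [hc, hc]
  linear_combination c * play_fair (a := a) (b := b) hq z

end Play

/-! ### Functions of a prefix and their conditional expectations -/

namespace InfString

variable {S : Type*}

@[simp] theorem length_take (v : InfString S) (t : ℕ) : (v.take t).length = t := by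
  simp [take]

theorem take_succ_inj {v w : InfString S} {t : ℕ} :
    v.take (t + 1) = w.take (t + 1) ↔ v.take t = w.take t ∧ v t = w t := by
  rw [take_succ, take_succ]
  constructor
  · intro h
    obtain ⟨h1, h2⟩ := List.append_inj h (by simp)
    exact ⟨h1, by simpa using h2⟩
  · rintro ⟨h1, h2⟩
    rw [h1, h2]

/-- The string that remains after the prefix of length `n`. -/
def drop (v : InfString S) (n : ℕ) : InfString S := fun i : ℕ => v (n + i)

theorem take_append_take_drop (v : InfString S) (n t : ℕ) :
    v.take n ++ (v.drop n).take t = v.take (n + t) := by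
  induction t with
  | zero => simp [take]
  | succ t ih => rw [take_succ, ← List.append_assoc, ih, ← add_assoc, take_succ, drop]

theorem mem_cylinder_iff {v : InfString S} {u : List S} : v ∈ cylinder u ↔ v.take u.length = u :=
  Iff.rfl

theorem mem_cylinder_take {v w : InfString S} {t : ℕ} :
    v ∈ cylinder (w.take t) ↔ v.take t = w.take t := by
  rw [mem_cylinder_iff, length_take]

theorem measurableSet_cylinder_sigmaAlg (u : List S) :
    MeasurableSet[sigmaAlg S u.length] (cylinder u) :=
  MeasurableSpace.measurableSet_generateFrom ⟨u, rfl, rfl⟩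

theorem measurableSet_cylinder (u : List S) : MeasurableSet (cylinder u) :=
  le_iSup (sigmaAlg S) u.length _ (measurableSet_cylinder_sigmaAlg u)

/-- The functions of the prefix of length `t`. -/
def PrefixMeasurable {β : Type*} (t : ℕ) (f : InfString S → β) : Prop :=
  Function.FactorsThrough f fun v => v.take t

theorem PrefixMeasurable.comp {β γ : Type*} {t : ℕ} {f : InfString S → β}
    (hf : PrefixMeasurable t f) (g : β → γ) : PrefixMeasurable t fun v => g (f v) :=
  fun _ _ h => congrArg g (hf h)

theorem exists_preimage_take {t : ℕ} {A : Set (InfString S)}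
    (hA : MeasurableSet[sigmaAlg S t] A) : ∃ L : Set (List S), A = (fun v => v.take t) ⁻¹' L := by
  have hle : sigmaAlg S t ≤ MeasurableSpace.comap (fun v : InfString S => v.take t) ⊤ := by
    refine MeasurableSpace.generateFrom_le ?_
    rintro _ ⟨u, rfl, rfl⟩
    exact ⟨{u}, trivial, rfl⟩
  obtain ⟨L, -, hL⟩ := hle _ hA
  exact ⟨L, hL.symm⟩

theorem preimage_take_eq (t : ℕ) (L : Set (List S)) :
    (fun v : InfString S => v.take t) ⁻¹' L = ⋃ u ∈ {u : List S | u.length = t} ∩ L, cylinder u := by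
  ext v
  simp only [Set.mem_preimage, Set.mem_iUnion, exists_prop, mem_cylinder_iff]
  constructor
  · exact fun h => ⟨v.take t, ⟨length_take v t, h⟩, by rw [length_take]⟩
  · rintro ⟨u, ⟨rfl, hu⟩, hv⟩
    rwa [hv]

/-- The product form also covers null cylinders, where both sides vanish. -/
theorem cond_mul_cylinder (P : Measure (InfString S)) [IsFiniteMeasure P] (w : List S) (s : S) :
    (cond P (cylinder w)).real (cylinder (w ++ [s])) * P.real (cylinder w) =
      P.real (cylinder (w ++ [s])) := by
  have hsub : cylinder (w ++ [s]) ⊆ cylinder w := by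
    rw [cylinder_eq_iUnion w]
    exact Set.subset_iUnion (fun s => cylinder (w ++ [s])) s
  rw [mul_comm, measureReal_def (cond _ _), cond_apply (measurableSet_cylinder w), ENNReal.toReal_mul,
    ENNReal.toReal_inv, ← measureReal_def, ← measureReal_def, Set.inter_eq_self_of_subset_right hsub]
  by_cases h : P.real (cylinder w) = 0
  · rw [h, zero_mul]
    exact (measureReal_mono_null hsub h).symm
  · rw [mul_inv_cancel_left₀ h]

section

variable [Finite S]

/-- A finite alphabet has only countably many finite strings, so `sigmaAlg S t` contains every union
of cylinders of length `t`. -/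
theorem measurableSet_preimage_take (t : ℕ) (L : Set (List S)) :
    MeasurableSet[sigmaAlg S t] ((fun v : InfString S => v.take t) ⁻¹' L) := by
  rw [preimage_take_eq]
  refine MeasurableSet.biUnion (Set.to_countable _) ?_
  rintro u ⟨rfl, -⟩
  exact measurableSet_cylinder_sigmaAlg u

theorem PrefixMeasurable.measurable {β : Type*} [MeasurableSpace β] {t : ℕ} {f : InfString S → β}
    (hf : PrefixMeasurable t f) : Measurable[sigmaAlg S t] f := by
  intro B _
  have : f ⁻¹' B = (fun v : InfString S => v.take t) ⁻¹' ((fun v => v.take t) '' (f ⁻¹' B)) := by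
    ext v
    constructor
    · exact fun h => ⟨v, h, rfl⟩
    · rintro ⟨w, hw, hwv⟩
      rw [Set.mem_preimage, ← hf hwv]
      exact hw
  rw [this]
  exact measurableSet_preimage_take t _

theorem PrefixMeasurable.stronglyMeasurable {t : ℕ} {f : InfString S → ℝ}
    (hf : PrefixMeasurable t f) : StronglyMeasurable[sigmaAlg S t] f :=
  hf.measurable.stronglyMeasurable

theorem PrefixMeasurable.measurableSet {t : ℕ} {p : InfString S → Prop}
    (hp : PrefixMeasurable t p) : MeasurableSet[sigmaAlg S t] {v | p v} :=
  by simpa [Set.preimage] using hp.measurable (measurableSet_singleton True)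

variable (P : Measure (InfString S))

section

variable [IsProbabilityMeasure P]

theorem PrefixMeasurable.integrable {t : ℕ} {f : InfString S → ℝ} (hf : PrefixMeasurable t f) :
    Integrable f P := by
  have hfin : (Set.range f).Finite := by
    obtain ⟨g, hg⟩ : ∃ g : List S → ℝ, ∀ v, f v = g (v.take t) :=
      ⟨Function.extend (fun v => v.take t) f 0, fun v => (hf.extend_apply 0 v).symm⟩
    refine ((List.finite_length_eq S t).image g).subset ?_
    rintro _ ⟨v, rfl⟩
    exact ⟨v.take t, length_take v t, (hg v).symm⟩
  obtain ⟨C, hC⟩ := hfin.isBounded.exists_norm_le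
  exact Integrable.of_bound
    (hf.stronglyMeasurable.mono (le_iSup (sigmaAlg S) t)).aestronglyMeasurable C
    (Filter.Eventually.of_forall fun v => hC _ ⟨v, rfl⟩)

/-- Conditional expectation of the outcome of a bet on the symbol at time `t`. -/
theorem condExp_ite_symbol (t : ℕ) (σ : List S → S) {f α β : InfString S → ℝ}
    (hα : PrefixMeasurable t α) (hβ : PrefixMeasurable t β)
    (hf1 : ∀ v, v t = σ (v.take t) → f v = α v) (hf0 : ∀ v, v t ≠ σ (v.take t) → f v = β v)
    {g : InfString S → ℝ}
    (hg : ∀ v, g v = (cond P (cylinder (v.take t))).real (cylinder (v.take t ++ [σ (v.take t)])) * α v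
      + (1 - (cond P (cylinder (v.take t))).real (cylinder (v.take t ++ [σ (v.take t)]))) * β v) :
    g =ᵐ[P] P[f | filtration S t] := by
  have hgm : PrefixMeasurable t g := by
    intro v w h
    have h' : v.take t = w.take t := h
    rw [hg, hg, h', hα h, hβ h]
  have hfm : PrefixMeasurable (t + 1) f := by
    intro v w h
    obtain ⟨h1, h2⟩ := take_succ_inj.1 h
    by_cases hv : v t = σ (v.take t)
    · rw [hf1 v hv, hf1 w (by rw [← h1, ← h2, hv]), hα h1]
    · rw [hf0 v hv, hf0 w (by rw [← h1, ← h2]; exact hv), hβ h1]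
  have hfi := hfm.integrable P
  have hgi := hgm.integrable P
  refine ae_eq_condExp_of_forall_setIntegral_eq ((filtration S).le t) hfi
    (fun _ _ _ => hgi.integrableOn) ?_ hgm.stronglyMeasurable.aestronglyMeasurable
  intro A hA _
  obtain ⟨L, rfl⟩ := exists_preimage_take hA
  have hfin : ({u : List S | u.length = t} ∩ L).Finite := (List.finite_length_eq S t).inter_of_left L
  have hU : (fun v : InfString S => v.take t) ⁻¹' L = ⋃ u ∈ hfin.toFinset, cylinder u := by
    rw [preimage_take_eq]
    simp
  have hdis : Set.Pairwise (↑hfin.toFinset) (Function.onFun Disjoint (cylinder (S := S))) := by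
    intro u hu w hw huw
    simp only [Set.Finite.coe_toFinset] at hu hw
    refine Set.disjoint_left.2 fun v hv hv' => huw ?_
    have h1 : u.length = t := hu.1
    have h2 : w.length = t := hw.1
    rw [mem_cylinder_iff, h1] at hv
    rw [mem_cylinder_iff, h2] at hv'
    rw [← hv, hv']
  rw [hU, integral_biUnion_finset _ (fun u _ => measurableSet_cylinder u) hdis
    (fun _ _ => hgi.integrableOn), integral_biUnion_finset _ (fun u _ => measurableSet_cylinder u)
    hdis (fun _ _ => hfi.integrableOn)]
  refine Finset.sum_congr rfl fun u hu => ?_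
  have hu' : u.length = t := ((Set.Finite.mem_toFinset hfin).1 hu).1
  subst hu'
  rcases (cylinder u).eq_empty_or_nonempty with h0 | ⟨v, hv⟩
  · simp [h0]
  -- On a single cylinder `g` is constant, while `f` is constant on the part continued by `σ u` and
  -- on the rest; it remains to compare masses.
  have hgc : ∫ x in cylinder u, g x ∂P = ∫ x in cylinder u, g v ∂P :=
    setIntegral_congr_fun (measurableSet_cylinder u) fun x hx => hgm (hx.trans hv.symm)
  have hsub : cylinder (u ++ [σ u]) ⊆ cylinder u := by
    rw [cylinder_eq_iUnion u]
    exact Set.subset_iUnion (fun s => cylinder (u ++ [s])) (σ u)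
  have hmem : ∀ x ∈ cylinder u, x ∈ cylinder (u ++ [σ u]) ↔ x u.length = σ (x.take u.length) := by
    intro x hx
    rw [mem_cylinder_iff] at hx ⊢
    simp [take_succ, hx]
  have h1 : ∫ x in cylinder (u ++ [σ u]), f x ∂P = ∫ x in cylinder (u ++ [σ u]), α v ∂P :=
    setIntegral_congr_fun (measurableSet_cylinder _) fun x hx => by
      rw [hf1 x ((hmem x (hsub hx)).1 hx)]
      exact hα ((hsub hx).trans hv.symm)
  have h2 : ∫ x in cylinder u \ cylinder (u ++ [σ u]), f x ∂P =
      ∫ x in cylinder u \ cylinder (u ++ [σ u]), β v ∂P :=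
    setIntegral_congr_fun ((measurableSet_cylinder _).diff (measurableSet_cylinder _))
      fun x hx => by
        rw [hf0 x fun h => hx.2 ((hmem x hx.1).2 h)]
        exact hβ (hx.1.trans hv.symm)
  have h3 := setIntegral_sdiff (measurableSet_cylinder (u ++ [σ u])) hfi.integrableOn hsub
  rw [hgc, ← sub_add_cancel (∫ x in cylinder u, f x ∂P) (∫ x in cylinder (u ++ [σ u]), f x ∂P),
    ← h3, h1, h2, setIntegral_const, setIntegral_const, setIntegral_const,
    measureReal_sdiff hsub (measurableSet_cylinder _), hg, mem_cylinder_iff.1 hv]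
  have := cond_mul_cylinder P u (σ u)
  simp only [smul_eq_mul]
  rw [← this]
  ring

end

/-- There are countably many null cylinders. Perpetual entropy speaks only of the others. -/
theorem ae_cylinder_take_ne_zero : ∀ᵐ v ∂P, ∀ t : ℕ, P (cylinder (v.take t)) ≠ 0 := by
  have : ∀ u : List S, P (cylinder u) = 0 → ∀ᵐ v ∂P, v ∉ cylinder u := fun u hu =>
    measure_eq_zero_iff_ae_notMem.1 hu
  have h : ∀ᵐ v ∂P, ∀ u : List S, P (cylinder u) = 0 → v ∉ cylinder u := by
    rw [ae_all_iff]
    intro u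
    by_cases hu : P (cylinder u) = 0
    · exact (this u hu).mono fun v hv _ => hv
    · exact Filter.Eventually.of_forall fun v h => absurd h hu
  exact h.mono fun v hv t ht => hv _ ht (mem_cylinder_take.2 rfl)

end

end InfString

/-! ### The strategy along a random string -/

namespace InfString

variable {S : Type*}

/-- The conditional probability that the string `w` is followed by the symbol `σ w`. -/
noncomputable def betProb (P : Measure (InfString S)) (σ : List S → S) (w : List S) : ℝ :=
  (cond P (cylinder w)).real (cylinder (w ++ [σ w]))

/-- The strings after which the strategy bets on the next symbol. -/
def IsBet (P : Measure (InfString S)) (σ : List S → S) (ε : ℝ) (w : List S) : Prop :=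
  ε < betProb P σ w ∧ betProb P σ w < 1 - ε

/-- The phase and the capital of the strategy at time `t`. -/
noncomputable def state (P : Measure (InfString S)) (σ : List S → S) (ε a b : ℝ) :
    ℕ → InfString S → ℕ × ℝ
  | 0, _ => (0, a)
  | t + 1, v => play a b (IsBet P σ ε (v.take t)) (betProb P σ (v.take t)) (v t = σ (v.take t))
      (state P σ ε a b t v)

/-- The strategy bets at time `t` and the bet reaches its aim. -/
def WinsAt (P : Measure (InfString S)) (σ : List S → S) (ε a b : ℝ) (t : ℕ)
    (v : InfString S) : Prop :=
  IsBet P σ ε (v.take t) ∧ WagerWins b (betProb P σ (v.take t)) (v t = σ (v.take t))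
    (state P σ ε a b t v).1 (state P σ ε a b t v).2

/-- The symbol is chosen as a function of the past string alone, which makes the bets predictable.
Where no symbol qualifies the choice is arbitrary and `IsBet` fails. -/
theorem PerpetualEntropy.exists_isBet [Nonempty S] {P : Measure (InfString S)}
    (hP : PerpetualEntropy P) : ∃ (σ : List S → S) (ε : ℝ), 0 < ε ∧
      ∀ (u : List S) (v : InfString S), 0 < P (cylinder u) →
        ∃ t : ℕ, IsBet P σ ε (u ++ v.take t) := by
  obtain ⟨ε, hε, h⟩ := hP
  have hσ : ∀ w : List S, ∃ s : S, (∃ s' : S,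
      ε < (cond P (cylinder w)).real (cylinder (w ++ [s'])) ∧
        (cond P (cylinder w)).real (cylinder (w ++ [s'])) < 1 - ε) →
      ε < (cond P (cylinder w)).real (cylinder (w ++ [s])) ∧
        (cond P (cylinder w)).real (cylinder (w ++ [s])) < 1 - ε := by
    intro w
    by_cases hw : ∃ s' : S, ε < (cond P (cylinder w)).real (cylinder (w ++ [s'])) ∧
        (cond P (cylinder w)).real (cylinder (w ++ [s'])) < 1 - ε
    · exact ⟨hw.choose, fun _ => hw.choose_spec⟩
    · exact ⟨Classical.arbitrary S, fun h => absurd h hw⟩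
  choose σ hσ using hσ
  refine ⟨σ, ε, hε, fun u v hu => ?_⟩
  obtain ⟨s, t, hst⟩ := h u v hu
  exact ⟨t, hσ _ ⟨s, hst⟩⟩

section Strategy

variable {P : Measure (InfString S)} {σ : List S → S} {ε a b : ℝ}

theorem IsBet.pos_and_lt_one (hε : 0 < ε) {w : List S} (h : IsBet P σ ε w) :
    0 < betProb P σ w ∧ betProb P σ w < 1 :=
  ⟨hε.trans h.1, by linarith [h.2]⟩

theorem admissible_state (hε : 0 < ε) (ha : 0 < a) (hab : a < b) (t : ℕ) (v : InfString S) :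
    Admissible a b (state P σ ε a b t v) := by
  induction t with
  | zero => exact ⟨ha.le, fun _ => le_rfl, fun _ => hab.le⟩
  | succ t ih => exact ih.play ha hab (IsBet.pos_and_lt_one hε) _

theorem prefixMeasurable_state (t : ℕ) : PrefixMeasurable t (state P σ ε a b t) := by
  induction t with
  | zero => exact fun _ _ _ => rfl
  | succ t ih =>
    intro v w h
    obtain ⟨h1, h2⟩ := take_succ_inj.1 h
    simp only [state]
    rw [h1, h2, ih h1]

theorem prefixMeasurable_winsAt (t : ℕ) : PrefixMeasurable (t + 1) (WinsAt P σ ε a b t) := by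
  intro v w h
  obtain ⟨h1, h2⟩ := take_succ_inj.1 h
  simp only [WinsAt]
  rw [h1, h2, prefixMeasurable_state t h1]

theorem natCast_le_upcrossingCount_state_iff (k : ℕ) (v : InfString S) :
    (k : ℕ∞) ≤ upcrossingCount a b (fun t => (state P σ ε a b t v).2) ↔
      ∃ t, 2 * k ≤ (state P σ ε a b t v).1 :=
  natCast_le_upcrossingCount_iff (N := fun t => (state P σ ε a b t v).1) rfl (fun _ => rfl) k

theorem monotone_state_fst (v : InfString S) : Monotone fun t => (state P σ ε a b t v).1 :=
  monotone_nat_of_le_succ fun _ => le_nextPhase ..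

theorem state_eq_of_ruined (hε : 0 < ε) (hb : 0 < b) {v : InfString S} {s : ℕ}
    (hn : ¬ Even (state P σ ε a b s v).1) (hx : (state P σ ε a b s v).2 = 0) {t : ℕ} (hst : s ≤ t) :
    state P σ ε a b t v = state P σ ε a b s v := by
  induction t, hst using Nat.le_induction with
  | base => rfl
  | succ t _ ih =>
    rw [state, ih]
    exact play_of_ruined hb (fun h => (IsBet.pos_and_lt_one hε h).1) _ hn hx

open Filter in
/-- If infinitely many bets are won, the phases tend to infinity or the capital is lost. -/
theorem tendsto_reachProb_state (hε : 0 < ε) (hb : 0 < b) (k : ℕ) {v : InfString S}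
    (h : ∃ᶠ t in atTop, WinsAt P σ ε a b t v) :
    Tendsto (fun t => reachProb a b k (state P σ ε a b t v)) atTop
      (nhds ({v | ∃ t, 2 * k ≤ (state P σ ε a b t v).1}.indicator 1 v)) := by
  by_cases hk : ∃ t, 2 * k ≤ (state P σ ε a b t v).1
  · obtain ⟨s, hs⟩ := hk
    rw [Set.indicator_of_mem (show v ∈ {v | ∃ t, 2 * k ≤ (state P σ ε a b t v).1} from ⟨s, hs⟩)]
    refine tendsto_const_nhds.congr' ?_
    filter_upwards [eventually_ge_atTop s] with t ht
    rw [reachProb, if_pos (hs.trans (monotone_state_fst v ht))]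
    rfl
  · rw [Set.indicator_of_notMem (by exact hk)]
    -- Without ruin every win would raise the phase, so phase `2 * k` would be reached.
    obtain ⟨s, hn, hx⟩ : ∃ s, ¬ Even (state P σ ε a b s v).1 ∧ (state P σ ε a b s v).2 = 0 := by
      by_contra hno
      have hinc : ∀ t, WinsAt P σ ε a b t v →
          (state P σ ε a b (t + 1) v).1 = (state P σ ε a b t v).1 + 1 := fun t ht =>
        (play_of_wins (a := a) _ ht.1 ht.2).resolve_right fun hr => hno ⟨t + 1, hr⟩
      have hunb : ∀ m, ∃ t, m ≤ (state P σ ε a b t v).1 := by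
        intro m
        induction m with
        | zero => exact ⟨0, Nat.zero_le _⟩
        | succ m ih =>
          obtain ⟨s, hs⟩ := ih
          obtain ⟨t, hst, ht⟩ := frequently_atTop.1 h s
          refine ⟨t + 1, ?_⟩
          rw [hinc t ht]
          exact Nat.succ_le_succ (hs.trans (monotone_state_fst v hst))
      exact hk (hunb _)
    refine tendsto_const_nhds.congr' ?_
    filter_upwards [eventually_ge_atTop s] with t ht
    rw [state_eq_of_ruined hε hb hn hx ht, reachProb, if_neg fun h => hk ⟨s, h⟩, if_neg hn, hx]
    simp

variable [Finite S] [IsProbabilityMeasure P]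

/-- Used twice: for the capital itself and for `reachProb`. -/
theorem martingale_comp_state (hε : 0 < ε) (ha : 0 < a) (hab : a < b) {φ : ℕ × ℝ → ℝ}
    (hφ : ∀ {q : ℝ} {bet : Prop} {z : ℕ × ℝ}, (bet → 0 < q ∧ q < 1) → Admissible a b z →
      q * φ (play a b bet q True z) + (1 - q) * φ (play a b bet q False z) = φ z) :
    Martingale (fun t v => φ (state P σ ε a b t v)) (filtration S) P := by
  have hm : ∀ t, PrefixMeasurable t fun v => φ (state P σ ε a b t v) := fun t =>
    (prefixMeasurable_state t).comp φ
  have hplay : ∀ (t : ℕ) (hit : Prop), PrefixMeasurable t fun v =>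
      φ (play a b (IsBet P σ ε (v.take t)) (betProb P σ (v.take t)) hit (state P σ ε a b t v)) := by
    intro t hit v w h
    have h' : v.take t = w.take t := h
    simp only [h', prefixMeasurable_state t h]
  refine martingale_nat (fun t => (hm t).stronglyMeasurable) (fun t => (hm t).integrable P)
    fun t => ?_
  refine condExp_ite_symbol P t σ (hplay t True) (hplay t False) (fun v hv => ?_) (fun v hv => ?_)
    fun v => ?_
  · simp only [state, eq_true hv]
  · simp only [state, eq_false hv]
  · exact (hφ (IsBet.pos_and_lt_one hε) (admissible_state hε ha hab t v)).symm

open Filter in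
theorem ae_frequently_winsAt (hε : 0 < ε)
    (hbet : ∀ (u : List S) (v : InfString S), 0 < P (cylinder u) →
      ∃ t : ℕ, IsBet P σ ε (u ++ v.take t)) :
    ∀ᵐ v ∂P, ∃ᶠ t in atTop, WinsAt P σ ε a b t v := by
  classical
  -- The index is shifted by one: a win at time `t` is known only at time `t + 1`.
  let A : ℕ → Set (InfString S) := fun t => t.casesOn ∅ fun t => {v | WinsAt P σ ε a b t v}
  have hA : ∀ t, MeasurableSet[filtration S t] (A t) := by
    rintro (_ | t)
    · exact @MeasurableSet.empty _ (filtration S 0)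
    · exact (prefixMeasurable_winsAt t).measurableSet
  let α : ℕ → Prop → InfString S → ℝ := fun t hit v =>
    if IsBet P σ ε (v.take t) ∧ WagerWins b (betProb P σ (v.take t)) hit
      (state P σ ε a b t v).1 (state P σ ε a b t v).2 then 1 else 0
  have hα : ∀ t hit, PrefixMeasurable t (α t hit) := by
    intro t hit v w h
    have h' : v.take t = w.take t := h
    simp only [α, h', prefixMeasurable_state t h]
  have hce : ∀ᵐ v ∂P, ∀ t, betProb P σ (v.take t) * α t True v +
      (1 - betProb P σ (v.take t)) * α t False v =
        (P[(A (t + 1)).indicator (1 : InfString S → ℝ) | filtration S t]) v := by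
    rw [ae_all_iff]
    intro t
    refine condExp_ite_symbol P t σ (hα t True) (hα t False) (fun v hv => ?_) (fun v hv => ?_)
      fun v => rfl
    · simp only [A, α, Set.indicator, Set.mem_ofPred_eq, WinsAt, eq_true hv, Pi.one_apply]
    · simp only [A, α, Set.indicator, Set.mem_ofPred_eq, WinsAt, eq_false hv, Pi.one_apply]
  -- The aim is reached with conditional probability `q` or `1 - q`; both exceed `ε`.
  have hbound : ∀ t v, (if IsBet P σ ε (v.take t) then ε else 0) ≤
      betProb P σ (v.take t) * α t True v + (1 - betProb P σ (v.take t)) * α t False v := by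
    intro t v
    by_cases hv : IsBet P σ ε (v.take t)
    · have h1 := hv.1
      have h2 := hv.2
      by_cases hc : Even (state P σ ε a b t v).1 ∨ betProb P σ (v.take t) * b ≤
        (state P σ ε a b t v).2
      · simp only [α, hv, hc, WagerWins, true_and, if_true, if_false]
        linarith
      · simp only [α, hv, hc, WagerWins, true_and, if_true, if_false, not_true, not_false_iff]
        linarith
    · simp [α, hv]
  filter_upwards [ae_cylinder_take_ne_zero P, hce, ae_mem_limsup_atTop_iff P hA] with v hv hcev hBC
  have hfreq : ∃ᶠ t in atTop, IsBet P σ ε (v.take t) := by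
    refine frequently_atTop.2 fun n => ?_
    -- Restarting the entropy condition after each prefix of `v` yields bets arbitrarily late.
    obtain ⟨t, ht⟩ := hbet (v.take n) (v.drop n) (pos_iff_ne_zero.2 (hv n))
    rw [take_append_take_drop] at ht
    exact ⟨n + t, by omega, ht⟩
  have htend : Tendsto (fun n => ∑ t ∈ Finset.range n,
      if IsBet P σ ε (v.take t) then ε else 0) atTop atTop := by
    have hnn : ∀ t, 0 ≤ if IsBet P σ ε (v.take t) then ε else 0 := fun t => by
      split_ifs
      exacts [hε.le, le_rfl]
    refine (not_summable_iff_tendsto_nat_atTop_of_nonneg hnn).1 fun hs => ?_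
    have := hs.tendsto_atTop_zero.eventually (gt_mem_nhds hε)
    obtain ⟨t, ht, ht'⟩ := (hfreq.and_eventually this).exists
    rw [if_pos ht] at ht'
    exact lt_irrefl _ ht'
  have hmem := hBC.2 (tendsto_atTop_mono (fun n => Finset.sum_le_sum fun t _ =>
    (hbound t v).trans_eq (hcev t)) htend)
  rw [mem_limsup_iff_frequently_mem] at hmem
  refine frequently_atTop.2 fun n => ?_
  obtain ⟨m, hm, hmA⟩ := frequently_atTop.1 hmem (n + 1)
  obtain _ | m := m
  · omega
  · exact ⟨m, by omega, hmA⟩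

open Filter in
theorem measureReal_reaches_phase (hε : 0 < ε) (ha : 0 < a) (hab : a < b)
    (hbet : ∀ (u : List S) (v : InfString S), 0 < P (cylinder u) →
      ∃ t : ℕ, IsBet P σ ε (u ++ v.take t)) (k : ℕ) :
    P.real {v | ∃ t, 2 * k ≤ (state P σ ε a b t v).1} = (a / b) ^ k := by
  have hM : Martingale (fun t v => reachProb a b k (state P σ ε a b t v)) (filtration S) P :=
    martingale_comp_state hε ha hab fun hq hz => reachProb_fair ha hab hq k hz
  have hmeas : MeasurableSet {v | ∃ t, 2 * k ≤ (state P σ ε a b t v).1} := by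
    rw [Set.ofPred_exists]
    exact MeasurableSet.iUnion fun t => (filtration S).le t _
      ((prefixMeasurable_state t).comp fun z => 2 * k ≤ z.1).measurableSet
  have hlim := tendsto_integral_of_dominated_convergence (μ := P)
    (F := fun t v => reachProb a b k (state P σ ε a b t v))
    (f := {v | ∃ t, 2 * k ≤ (state P σ ε a b t v).1}.indicator 1) (fun _ => (1 : ℝ))
    (fun t => (hM.integrable t).aestronglyMeasurable) (integrable_const 1)
    (fun t => Eventually.of_forall fun v => by
      have := reachProb_mem_Icc ha hab k (admissible_state (P := P) (σ := σ) hε ha hab t v)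
      rw [Real.norm_of_nonneg this.1]
      exact this.2)
    ((ae_frequently_winsAt hε hbet).mono fun v hv =>
      tendsto_reachProb_state hε (ha.trans hab) k hv)
  have hconst : ∀ t, ∫ v, reachProb a b k (state P σ ε a b t v) ∂P = (a / b) ^ k := by
    intro t
    have h0 : ∀ v, reachProb a b k (state P σ ε a b 0 v) = (a / b) ^ k := by
      intro v
      rcases Nat.eq_zero_or_pos k with rfl | hk
      · simp [reachProb, state]
      · simp [reachProb, state, hk.ne']
    have := hM.setIntegral_eq (Nat.zero_le t) (MeasurableSet.univ)
    simpa [h0] using this.symm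
  simp only [hconst] at hlim
  rw [integral_indicator_one hmeas] at hlim
  exact tendsto_nhds_unique hlim tendsto_const_nhds |>.symm ▸ rfl

end Strategy

end InfString

theorem mainTheorem11 {S : Type*} [Finite S] [Nontrivial S]
    (P : Measure (InfString S)) [IsProbabilityMeasure P] (hP : InfString.PerpetualEntropy P)
    (a b : ℝ) (ha : 0 < a) (hab : a < b) :
    ∃ X : ℕ → InfString S → ℝ,
      Martingale X (InfString.filtration S) P ∧
      (∀ t v, 0 ≤ X t v) ∧
      (∀ v, X 0 v = a) ∧
      ∀ k : ℕ,
        P.real {v | (k : ℕ∞) ≤ upcrossingCount a b (fun t => X t v)} = a ^ k / b ^ k ∧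
        P.real {v | (k : ℕ∞) ≤ upcrossingCount a b (fun t => X t v)} =
          (a / b) ^ k * ∫ v, min (X 0 v / a) 1 ∂P := by
  obtain ⟨σ, ε, hε, hbet⟩ := hP.exists_isBet
  refine ⟨fun t v => (InfString.state P σ ε a b t v).2,
    InfString.martingale_comp_state (φ := Prod.snd) hε ha hab fun hq _ => play_fair hq _,
    fun t v => (InfString.admissible_state hε ha hab t v).1, fun _ => rfl, fun k => ?_⟩
  have h : P.real {v | (k : ℕ∞) ≤
      upcrossingCount a b (fun t => (InfString.state P σ ε a b t v).2)} = (a / b) ^ k := by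
    simp only [InfString.natCast_le_upcrossingCount_state_iff]
    exact InfString.measureReal_reaches_phase hε ha hab hbet k
  refine ⟨by rw [h, div_pow], ?_⟩
  rw [h]
  simp [InfString.state, div_self ha.ne']
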